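/- A digraph on $[n]=\{1,\dots,n\}$ is a set of ordered pairs of distinct elements of $[n]$ (its edges); a descent is an edge $(s,t)$ with $s>t$. A rooted tree is an acyclic digraph in which one vertex (the root) has outdegree $0$ and every other vertex has outdegree $1$. A leaf is a vertex of indegree $0$, except that the vertex of a one-vertex tree is not counted as a leaf. Let $t_n(u;\alpha)=\sum_D u^{\mathrm{des}(D)}\alpha^{\mathrm{leaves}(D)}$, summed over all rooted trees $D$ with vertex set $[n]$, let $$T(x,u;\alpha)=\sum_{n\ge 0} t_n(u;\alpha)\frac{x^n}{n!},$$ and let $T(x,u)=T(x,u;1)$. Then, as formal power series in $x$, $$T(x,u;\alpha+1)=T\left(\frac{e^{\alpha x}-e^{\alpha u x}}{\alpha(1-u)},\,u\right).$$ Moreover, $T(x,u)$ is the compositional inverse (as a power series in $x$) of $$\frac{e^{-x}-e^{-ux}}{u-1}=\sum_{n\ge 1}(-1)^{n-1}(1+u+\cdots+u^{n-1})\frac{x^n}{n!}.$$ Here $u$ and $\alpha$ are indeterminates or, more generally, arbitrary elements of a commutative $\mathbb{Q}$-algebra, the quotient $\frac{e^{\alpha x}-e^{\alpha u x}}{\alpha(1-u)}$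 being understood as the power series $\sum_{n\ge1}(1+u+\cdots+u^{n-1})\alpha^{n-1}x^n/n!$ obtained by carrying out the division (and likewise for the second quotient). -/

import Mathlib

namespace DescentTrees

open scoped Classical in
/-- Outdegree of `v`: the number of edges `(v, w)`. -/
noncomputable def outdeg {n : ℕ} (D : Digraph (Fin n)) (v : Fin n) : ℕ :=
  (Finset.univ.filter fun w => D.Adj v w).card

open scoped Classical in
/-- Indegree of `v`: the number of edges `(w, v)`. -/
noncomputable def indeg {n : ℕ} (D : Digraph (Fin n)) (v : Fin n) : ℕ :=
  (Finset.univ.filter fun w => D.Adj w v).card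

/-- No nonempty directed path leads from a vertex to itself (in particular there are no loops). -/
def IsAcyclic {n : ℕ} (D : Digraph (Fin n)) : Prop :=
  ∀ v, ¬ Relation.TransGen D.Adj v v

/-- A rooted tree: an acyclic digraph in which one vertex (the root) has outdegree `0` and every
other vertex has outdegree `1`. -/
def IsRootedTree {n : ℕ} (D : Digraph (Fin n)) : Prop :=
  IsAcyclic D ∧ ∃ r, outdeg D r = 0 ∧ ∀ v, v ≠ r → outdeg D v = 1

open scoped Classical in
/-- Number of descents: edges `(s, t)` with `s > t`. -/
noncomputable def numDescents {n : ℕ} (D : Digraph (Fin n)) : ℕ :=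
  (Finset.univ.filter fun e : Fin n × Fin n => D.Adj e.1 e.2 ∧ e.2 < e.1).card

open scoped Classical in
/-- Number of leaves: vertices of indegree `0`, except that the only vertex of a one-vertex tree
is not a leaf. -/
noncomputable def numLeaves {n : ℕ} (D : Digraph (Fin n)) : ℕ :=
  if n = 1 then 0 else (Finset.univ.filter fun v => indeg D v = 0).card

open scoped Classical in
/-- `t_n(u; α)`: the sum of `u ^ descents * α ^ leaves` over all rooted trees on an `n`-element
totally ordered vertex set. -/
noncomputable def treeSum {R : Type*} [CommRing R] (u α : R) (n : ℕ) : R :=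
  ∑ D ∈ Finset.univ.filter (fun D : Digraph (Fin n) => IsRootedTree D),
    u ^ numDescents D * α ^ numLeaves D

/-- `T(x, u; α) = ∑ t_n(u; α) x ^ n / n!`, a power series in `x`. -/
noncomputable def treeEGF {R : Type*} [CommRing R] [Algebra ℚ R] (u α : R) : PowerSeries R :=
  PowerSeries.mk fun n => algebraMap ℚ R (1 / (n.factorial : ℚ)) * treeSum u α n

/-- The power series `e ^ (a x)`. -/
noncomputable def expSeries {R : Type*} [CommRing R] [Algebra ℚ R] (a : R) : PowerSeries R :=
  PowerSeries.rescale a (PowerSeries.exp R)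

/-- The power series `∑_{n ≥ 1} (1 + u + ⋯ + u ^ (n - 1)) a ^ (n - 1) x ^ n / n!`, which is
`(e ^ (a x) - e ^ (a u x)) / (a (1 - u))` with the division carried out. -/
noncomputable def expQuotient {R : Type*} [CommRing R] [Algebra ℚ R] (a u : R) : PowerSeries R :=
  PowerSeries.mk fun n => if n = 0 then 0 else
    algebraMap ℚ R (1 / (n.factorial : ℚ)) * (a ^ (n - 1) * ∑ i ∈ Finset.range n, u ^ i)

end DescentTrees

/-!
The functional equation rests on a bijection. Expanding `(α + 1) ^ leaves` amounts to marking some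
leaves of a tree on `[n]` and giving each of them the weight `α`. The root is never a leaf, so the
unmarked vertices form a tree again, and every marked leaf is attached to one of them by an
arbitrary edge; this determines the marked tree. After relabelling the set `K` of unmarked vertices
in increasing order, with `k = |K|`, the descents split into those of the smaller tree and those
of the new edges (`sum_trees_with_leaves_off_range`, `treeSum_add_one`). Thus `t_n(u; α + 1)` is
the sum over `k` of `t_k(u; 1)` times a sum `attachmentSum` over the `k`-subsets `K`, which records
the attachments only.

The generating function of these attachments is `S ^ k / k!`, where `S` is the quotient
`(e ^ (α x) - e ^ (α u x)) / (α (1 - u))`. Instead of dividing the vertices into blocks, the proof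
compares two recursions. Allowing an additional external target of weight `c`, the largest vertex
is either an attached leaf, which contributes the factor `α (c + k u)`, or an element of `K`, which
raises `c` by `1` for all other vertices. On the other side `S' = e ^ (α x) + α u S`, so that
`(e ^ (c α x) S ^ k)' = α (c + k u) e ^ (c α x) S ^ k + k e ^ ((c + 1) α x) S ^ (k - 1)`, which is
the same recursion (`factorial_mul_coeff_expSeries_mul_expQuotient_pow`).

For `α = -1` the left side `T(x, u; 0)` counts trees without leaves, hence equals `x`, while `S`
becomes `(e ^ (-x) - e ^ (-u x)) / (u - 1)`. So this series is a right inverse of `T(x, u)` under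
composition, and since its linear coefficient is `1` it is a two-sided inverse.
-/

namespace DescentTrees

open Finset PowerSeries

/-! ### Power series and attached leaves -/

section Series

variable {R : Type*} [CommRing R]

theorem eq_of_C_mul_eq {b : R} (hb : b ∈ nonZeroDivisors R) {f g : PowerSeries R}
    (h : C b * f = C b * g) : f = g := by
  ext n
  have := congrArg (coeff n) h
  rw [coeff_C_mul, coeff_C_mul] at this
  exact (mul_cancel_left_mem_nonZeroDivisors hb).1 this

theorem coeff_subst_eq_sum_range (f g : PowerSeries R) (hg : constantCoeff g = 0) (n : ℕ) :
    coeff n (subst g f) = ∑ k ∈ range (n + 1), coeff k f * coeff n (g ^ k) := by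
  rw [coeff_subst' (HasSubst.of_constantCoeff_zero' hg)]
  simp only [smul_eq_mul]
  refine finsum_eq_sum_of_support_subset _ fun k hk => ?_
  by_contra hkn
  refine hk ?_
  have hnk : n < k := by simpa using hkn
  dsimp only
  rw [coeff_of_lt_order n (lt_of_lt_of_le (by exact_mod_cast hnk)
    (le_order_pow_of_constantCoeff_eq_zero k hg)), mul_zero]

/-- A left compositional inverse of a power series with unit linear coefficient is also a right
inverse. -/
theorem subst_eq_X_of_subst_eq_X {f g : PowerSeries R} (hf : constantCoeff f = 0)
    (hf1 : IsUnit (coeff 1 f)) (h : subst f g = (X : PowerSeries R)) :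
    subst g f = (X : PowerSeries R) := by
  have hs := HasSubst.of_constantCoeff_zero' hf
  have hi := HasSubst.substInvOfIsUnit f hf1
  have h_right := subst_substInvOfIsUnit_right f hf hf1
  have key := subst_comp_subst_apply hs hi g
  rw [h, subst_X hi] at key
  have hg : f.substInvOfIsUnit hf1 = g := by
    rw [h_right, X_subst] at key
    exact key
  rw [← hg]
  exact h_right

/-- The total weight of all choices of a `k`-subset `K` of `s` and of a target for every element of
`s` outside `K`. An element `m` contributes the factor `a`, times `c` if its target is external, and
times `u` if its target is some `r` in `K` with `r < m`, that is, if the edge `(m, r)` is a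
descent. -/
noncomputable def attachmentSum {V : Type*} [LinearOrder V] (a u : R) (s : Finset V) (k : ℕ)
    (c : R) : R :=
  ∑ K ∈ powersetCard k s, ∏ m ∈ s \ K, a * (c + ∑ r ∈ K, if r < m then u else 1)

section Recursion

variable {V : Type*} [LinearOrder V] (a u c : R) {s : Finset V} {x : V}

theorem attachmentSum_insert_zero (hx : ∀ y ∈ s, y < x) :
    attachmentSum a u (insert x s) 0 c = a * c * attachmentSum a u s 0 c := by
  have hxs : x ∉ s := fun h => lt_irrefl x (hx x h)
  simp [attachmentSum, prod_insert hxs]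

/-- The maximum of the ground set either is attached, and then it makes a descent with any of the
`k + 1` targets, or it is a target itself, which makes a descent with no other element and so acts
as an additional external target of weight `1`. -/
theorem attachmentSum_insert_succ (hx : ∀ y ∈ s, y < x) (k : ℕ) :
    attachmentSum a u (insert x s) (k + 1) c =
      a * (c + (k + 1 : ℕ) * u) * attachmentSum a u s (k + 1) c +
        attachmentSum a u s k (c + 1) := by
  have hxs : x ∉ s := fun h => lt_irrefl x (hx x h)
  unfold attachmentSum
  rw [powersetCard_succ_insert hxs, sum_union, sum_image]
  · congr 1
    · rw [mul_sum]
      refine sum_congr rfl fun K hK => ?_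
      obtain ⟨hKs, hKc⟩ := mem_powersetCard.1 hK
      have hxK : x ∉ K := fun h => hxs (hKs h)
      rw [insert_sdiff_of_notMem _ hxK, prod_insert (fun h => hxs (mem_sdiff.1 h).1)]
      congr 3
      rw [sum_congr rfl fun r hr => if_pos (hx r (hKs hr)), sum_const, hKc, nsmul_eq_mul]
    · refine sum_congr rfl fun K hK => ?_
      obtain ⟨hKs, hKc⟩ := mem_powersetCard.1 hK
      have hxK : x ∉ K := fun h => hxs (hKs h)
      have : insert x s \ insert x K = s \ K := by
        ext y
        simp only [mem_sdiff, mem_insert]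
        grind
      rw [this]
      refine prod_congr rfl fun m hm => ?_
      rw [sum_insert hxK, if_neg (hx m (mem_sdiff.1 hm).1).not_gt, add_assoc]
  · intro K hK L hL h
    have hxK : x ∉ K := fun h => hxs ((mem_powersetCard.1 hK).1 h)
    have hxL : x ∉ L := fun h => hxs ((mem_powersetCard.1 hL).1 h)
    rw [← erase_insert hxK, ← erase_insert hxL]
    exact congrArg (fun t => erase t x) h
  · rw [disjoint_left]
    intro K hK hK'
    obtain ⟨L, -, rfl⟩ := mem_image.1 hK'
    exact hxs ((mem_powersetCard.1 hK).1 (mem_insert_self x L))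

end Recursion

variable [Algebra ℚ R]

theorem natCast_mul_algebraMap_factorial (n : ℕ) :
    (n.factorial : R) * algebraMap ℚ R (1 / (n.factorial : ℚ)) = 1 := by
  rw [← map_natCast (algebraMap ℚ R) n.factorial, ← map_mul,
    mul_one_div_cancel (by exact_mod_cast n.factorial_ne_zero), map_one]

theorem algebraMap_factorial_succ (n : ℕ) :
    algebraMap ℚ R (1 / ((n + 1).factorial : ℚ)) * (n + 1) =
      algebraMap ℚ R (1 / (n.factorial : ℚ)) := by
  have h : ((n : R) + 1) = algebraMap ℚ R (n + 1) := by simp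
  rw [h, ← map_mul, Nat.factorial_succ]
  congr 1
  have : (n.factorial : ℚ) ≠ 0 := by exact_mod_cast n.factorial_ne_zero
  have h' : (n : ℚ) + 1 ≠ 0 := by positivity
  push_cast
  field_simp

theorem coeff_expSeries (a : R) (n : ℕ) :
    coeff n (expSeries a) = a ^ n * algebraMap ℚ R (1 / (n.factorial : ℚ)) := by
  simp only [expSeries, coeff_rescale, coeff_exp]

theorem constantCoeff_expSeries (a : R) : constantCoeff (expSeries a) = 1 := by
  rw [← coeff_zero_eq_constantCoeff_apply, coeff_expSeries]
  simp

theorem expSeries_mul_expSeries (a b : R) :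
    expSeries a * expSeries b = expSeries (a + b) :=
  exp_mul_exp_eq_exp_add a b

theorem derivative_expSeries (a : R) :
    derivative R (expSeries a) = C a * expSeries a := by
  ext n
  rw [coeff_derivative, coeff_C_mul, coeff_expSeries, coeff_expSeries,
    ← algebraMap_factorial_succ n]
  ring

theorem coeff_expQuotient_succ (a u : R) (n : ℕ) :
    coeff (n + 1) (expQuotient a u) =
      algebraMap ℚ R (1 / ((n + 1).factorial : ℚ)) * (a ^ n * ∑ i ∈ range (n + 1), u ^ i) := by
  simp [expQuotient]

theorem constantCoeff_expQuotient (a u : R) : constantCoeff (expQuotient a u) = 0 := by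
  rw [← coeff_zero_eq_constantCoeff_apply]
  simp [expQuotient]

theorem C_mul_expQuotient (a u : R) :
    C (a * (1 - u)) * expQuotient a u = expSeries a - expSeries (a * u) := by
  ext n
  rw [coeff_C_mul, map_sub, coeff_expSeries, coeff_expSeries]
  cases n with
  | zero => simp [expQuotient]
  | succ n =>
    rw [coeff_expQuotient_succ]
    linear_combination -(a ^ (n + 1) * algebraMap ℚ R (1 / ((n + 1).factorial : ℚ))) *
      geom_sum_mul u (n + 1)

/-- The differential equation that drives the recursion for the powers of `expQuotient a u`; it
holds for all `a` and `u`, also where the quotient itself makes no sense. -/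
theorem derivative_expQuotient (a u : R) :
    derivative R (expQuotient a u) = expSeries a + C (a * u) * expQuotient a u := by
  ext n
  rw [coeff_derivative, coeff_expQuotient_succ, map_add, coeff_expSeries, coeff_C_mul]
  have h := algebraMap_factorial_succ (R := R) n
  cases n with
  | zero => simp [expQuotient]
  | succ n =>
    rw [coeff_expQuotient_succ, sum_range_succ', ← h]
    simp_rw [pow_succ u, ← sum_mul]
    ring

/-- For `k = 0` the truncated exponent `k - 1` is harmless, as its term has the factor `k`. -/
theorem derivative_expSeries_mul_expQuotient_pow (a u c : R) (k : ℕ) :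
    derivative R (expSeries (c * a) * expQuotient a u ^ k) =
      C (a * (c + k * u)) * (expSeries (c * a) * expQuotient a u ^ k) +
        C (k : R) * (expSeries ((c + 1) * a) * expQuotient a u ^ (k - 1)) := by
  rw [add_mul c, one_mul, ← expSeries_mul_expSeries, Derivation.leibniz, derivative_pow,
    derivative_expSeries, derivative_expQuotient]
  cases k with
  | zero => simp; ring
  | succ k =>
    simp only [smul_eq_mul, map_mul, map_add, map_natCast, Nat.add_sub_cancel]
    ring

/-- `attachmentSum` counts with the exponential generating function `e ^ (c a x) S ^ k / k!`, where
`S` is `expQuotient a u`; both sides satisfy the same recursion in the size of `s`. -/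
theorem factorial_mul_coeff_expSeries_mul_expQuotient_pow {V : Type*} [LinearOrder V]
    (a u : R) (s : Finset V) : ∀ (k : ℕ) (c : R),
    (s.card.factorial : R) * coeff s.card (expSeries (c * a) * expQuotient a u ^ k) =
      k.factorial * attachmentSum a u s k c := by
  induction s using Finset.induction_on_max with
  | empty =>
    intro k c
    rw [card_empty, coeff_zero_eq_constantCoeff_apply, map_mul, map_pow, constantCoeff_expSeries,
      constantCoeff_expQuotient]
    cases k with
    | zero => simp [attachmentSum]
    | succ k => simp [attachmentSum]
  | insert x s hx ih =>
    intro k c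
    have hxs : x ∉ s := fun h => lt_irrefl x (hx x h)
    have hd := congrArg (coeff s.card) (derivative_expSeries_mul_expQuotient_pow a u c k)
    rw [coeff_derivative, map_add, coeff_C_mul, coeff_C_mul] at hd
    have h1 := ih k c
    rw [card_insert_of_notMem hxs, Nat.factorial_succ]
    push_cast
    cases k with
    | zero =>
      rw [attachmentSum_insert_zero a u c hx]
      push_cast at hd h1 ⊢
      linear_combination (s.card.factorial : R) * hd + a * c * h1
    | succ k =>
      have h2 := ih k (c + 1)
      rw [attachmentSum_insert_succ a u c hx]
      rw [Nat.add_sub_cancel] at hd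
      rw [Nat.factorial_succ] at h1 ⊢
      push_cast at hd h1 ⊢
      linear_combination (s.card.factorial : R) * hd + a * (c + (k + 1) * u) * h1 + (k + 1) * h2

end Series

/-! ### Rooted trees and their leaves -/

section Tree

variable {n : ℕ} {D : Digraph (Fin n)}

theorem outdeg_eq_zero_iff {v : Fin n} : outdeg D v = 0 ↔ ∀ w, ¬ D.Adj v w := by
  simp [outdeg, filter_eq_empty_iff]

theorem indeg_eq_zero_iff {v : Fin n} : indeg D v = 0 ↔ ∀ w, ¬ D.Adj w v := by
  simp [indeg, filter_eq_empty_iff]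

theorem outdeg_eq_one_iff {v : Fin n} : outdeg D v = 1 ↔ ∃! w, D.Adj v w := by
  rw [outdeg, card_eq_one]
  constructor
  · rintro ⟨w, hw⟩
    have h (y : Fin n) : D.Adj v y ↔ y = w := by simpa using congrArg (y ∈ ·) hw
    exact ⟨w, (h w).2 rfl, fun y hy => (h y).1 hy⟩
  · rintro ⟨w, hw, hu⟩
    refine ⟨w, ?_⟩
    ext y
    simp only [mem_filter, mem_univ, true_and, mem_singleton]
    exact ⟨hu y, fun h => h ▸ hw⟩

theorem isRootedTree_iff : IsRootedTree D ↔
    IsAcyclic D ∧ ∃ r, (∀ w, ¬ D.Adj r w) ∧ ∀ v, v ≠ r → ∃! w, D.Adj v w := by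
  simp only [IsRootedTree, outdeg_eq_zero_iff, outdeg_eq_one_iff]

theorem IsRootedTree.one_le (hD : IsRootedTree D) : 1 ≤ n := by
  obtain ⟨-, r, -⟩ := hD
  exact r.pos

open scoped Classical in
/-- The set of leaves that `numLeaves` counts; it is empty for a one-vertex tree. -/
noncomputable def leafSet (D : Digraph (Fin n)) : Finset (Fin n) :=
  if n = 1 then ∅ else univ.filter fun v => indeg D v = 0

theorem numLeaves_eq_card_leafSet (D : Digraph (Fin n)) : numLeaves D = (leafSet D).card := by
  unfold numLeaves leafSet
  split_ifs <;> simp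

theorem mem_leafSet {v : Fin n} : v ∈ leafSet D ↔ n ≠ 1 ∧ ∀ w, ¬ D.Adj w v := by
  unfold leafSet
  split_ifs with h <;> simp [h, indeg_eq_zero_iff]

/-- Reachability in an acyclic finite digraph is well-founded against the edge directions. -/
theorem IsAcyclic.wellFounded_swap (hD : IsAcyclic D) :
    WellFounded (Function.swap (Relation.TransGen D.Adj)) := by
  have : IsTrans (Fin n) (Function.swap (Relation.TransGen D.Adj)) :=
    ⟨fun _ _ _ h₁ h₂ => Relation.TransGen.trans h₂ h₁⟩
  have : Std.Irrefl (Function.swap (Relation.TransGen D.Adj)) := ⟨hD⟩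
  exact Finite.wellFounded_of_trans_of_irrefl _

theorem IsAcyclic.wellFounded (hD : IsAcyclic D) :
    WellFounded (Relation.TransGen D.Adj) := by
  have : Std.Irrefl (Relation.TransGen D.Adj) := ⟨hD⟩
  exact Finite.wellFounded_of_trans_of_irrefl _

/-- The root is not a leaf: otherwise no edge leads to it, and a vertex other than the root with no
other such vertex reachable from it would have no parent. -/
theorem IsRootedTree.exists_adj_of_mem_leafSet (hD : IsRootedTree D) {v : Fin n}
    (hv : v ∈ leafSet D) : ∃! w, D.Adj v w := by
  obtain ⟨hac, r, -, hp⟩ := isRootedTree_iff.1 hD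
  refine hp v ?_
  rintro rfl
  obtain ⟨hn, hv⟩ := mem_leafSet.1 hv
  have hnt : Nontrivial (Fin n) := Fin.nontrivial_iff_two_le.2 (by have := v.pos; omega)
  obtain ⟨m, hm, hmin⟩ := hac.wellFounded_swap.has_min {w | w ≠ v} (exists_ne v)
  obtain ⟨w, hw, -⟩ := hp m hm
  exact hmin w (by rintro rfl; exact hv m hw) (Relation.TransGen.single hw)

theorem IsRootedTree.leafSet_nonempty (hD : IsRootedTree D) (hn : n ≠ 1) :
    (leafSet D).Nonempty := by
  obtain ⟨hac, r, -⟩ := hD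
  obtain ⟨v, -, hv⟩ := hac.wellFounded.has_min Set.univ ⟨r, trivial⟩
  exact ⟨v, mem_leafSet.2 ⟨hn, fun w hw => hv w trivial (Relation.TransGen.single hw)⟩⟩

theorem isRootedTree_fin_one_iff {D : Digraph (Fin 1)} : IsRootedTree D ↔ D = ⊥ := by
  rw [isRootedTree_iff]
  constructor
  · rintro ⟨-, r, hr, -⟩
    ext v w
    simpa [Subsingleton.elim v r] using hr w
  · rintro rfl
    refine ⟨fun v h => ?_, 0, fun w => id, fun v hv => absurd (Subsingleton.elim v 0) hv⟩
    obtain ⟨w, hw, -⟩ := Relation.TransGen.head'_iff.1 h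
    exact hw

theorem treeSum_zero_leaf_weight {R : Type*} [CommRing R] (u : R) (n : ℕ) :
    treeSum u 0 n = if n = 1 then 1 else 0 := by
  classical
  unfold treeSum
  split_ifs with hn
  · subst hn
    simp only [isRootedTree_fin_one_iff]
    rw [filter_eq' univ (⊥ : Digraph (Fin 1)), if_pos (mem_univ _), sum_singleton]
    simp [numDescents, numLeaves]
  · refine sum_eq_zero fun D hD => ?_
    have h := ((mem_filter.1 hD).2.leafSet_nonempty hn).card_pos
    rw [numLeaves_eq_card_leafSet, zero_pow h.ne', mul_zero]

end Tree

/-! ### Attaching leaves to a tree -/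

section Attach

variable {k n : ℕ} (e : Fin k ↪o Fin n)

/-- The digraph on `Fin n` formed by a copy of `D` on the range of `e` and an edge from every other
vertex `m` to the copy of `f m`. -/
def attachLeaves (D : Digraph (Fin k)) (f : {m // m ∉ Set.range e} → Fin k) :
    Digraph (Fin n) where
  Adj x y := (∃ i j, e i = x ∧ e j = y ∧ D.Adj i j) ∨ ∃ m, m.1 = x ∧ e (f m) = y

variable {e} {D : Digraph (Fin k)} {f : {m // m ∉ Set.range e} → Fin k}

theorem attachLeaves_adj_coe {i : Fin k} {y : Fin n} :
    (attachLeaves e D f).Adj (e i) y ↔ ∃ j, e j = y ∧ D.Adj i j := by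
  constructor
  · rintro (⟨i', j, hi, hj, h⟩ | ⟨m, hm, -⟩)
    · exact ⟨j, hj, e.injective hi ▸ h⟩
    · exact absurd ⟨i, hm.symm⟩ m.2
  · rintro ⟨j, hj, h⟩
    exact Or.inl ⟨i, j, rfl, hj, h⟩

theorem attachLeaves_adj_coe_coe {i j : Fin k} :
    (attachLeaves e D f).Adj (e i) (e j) ↔ D.Adj i j := by
  simp [attachLeaves_adj_coe]

theorem attachLeaves_adj_leaf {m : {m // m ∉ Set.range e}} {y : Fin n} :
    (attachLeaves e D f).Adj m y ↔ e (f m) = y := by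
  constructor
  · rintro (⟨i, j, hi, -, -⟩ | ⟨m', hm, h⟩)
    · exact absurd ⟨i, hi⟩ m.2
    · exact Subtype.ext hm ▸ h
  · exact fun h => Or.inr ⟨m, rfl, h⟩

theorem mem_range_of_attachLeaves_adj {x y : Fin n} (h : (attachLeaves e D f).Adj x y) :
    y ∈ Set.range e := by
  obtain ⟨i, j, -, hj, -⟩ | ⟨m, -, hm⟩ := h
  · exact ⟨j, hj⟩
  · exact ⟨f m, hm⟩

theorem transGen_of_transGen_attachLeaves {i : Fin k} {y : Fin n}
    (h : Relation.TransGen (attachLeaves e D f).Adj (e i) y) :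
    ∃ j, e j = y ∧ Relation.TransGen D.Adj i j := by
  induction h with
  | single h =>
    obtain ⟨j, hj, hij⟩ := attachLeaves_adj_coe.1 h
    exact ⟨j, hj, .single hij⟩
  | tail _ h ih =>
    obtain ⟨j, rfl, hij⟩ := ih
    obtain ⟨l, hl, hjl⟩ := attachLeaves_adj_coe.1 h
    exact ⟨l, hl, hij.tail hjl⟩

theorem isRootedTree_attachLeaves (hD : IsRootedTree D) : IsRootedTree (attachLeaves e D f) := by
  obtain ⟨hac, r, hr, hp⟩ := isRootedTree_iff.1 hD
  refine isRootedTree_iff.2 ⟨fun v hv => ?_, e r, fun w hw => ?_, fun v hv => ?_⟩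
  · obtain ⟨w, -, hw⟩ := Relation.TransGen.tail'_iff.1 hv
    obtain ⟨i, rfl⟩ := mem_range_of_attachLeaves_adj hw
    obtain ⟨j, hj, hij⟩ := transGen_of_transGen_attachLeaves hv
    exact hac i (e.injective hj ▸ hij)
  · obtain ⟨j, -, h⟩ := attachLeaves_adj_coe.1 hw
    exact hr j h
  · by_cases hm : v ∈ Set.range e
    · obtain ⟨i, rfl⟩ := hm
      obtain ⟨j, hj, hu⟩ := hp i (by rintro rfl; exact hv rfl)
      refine ⟨e j, attachLeaves_adj_coe_coe.2 hj, fun y hy => ?_⟩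
      obtain ⟨l, rfl, hl⟩ := attachLeaves_adj_coe.1 hy
      rw [hu l hl]
    · exact ⟨e (f ⟨v, hm⟩), (attachLeaves_adj_leaf (m := ⟨v, hm⟩)).2 rfl,
        fun y hy => ((attachLeaves_adj_leaf (m := ⟨v, hm⟩)).1 hy).symm⟩

theorem mem_leafSet_attachLeaves (hD : IsRootedTree D) {m : Fin n} (hm : m ∉ Set.range e) :
    m ∈ leafSet (attachLeaves e D f) := by
  refine mem_leafSet.2 ⟨?_, fun w hw => hm (mem_range_of_attachLeaves_adj hw)⟩
  rintro rfl
  exact hm ⟨⟨0, hD.one_le⟩, Subsingleton.elim _ _⟩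

theorem attachLeaves_injective {D' : Digraph (Fin k)} {f' : {m // m ∉ Set.range e} → Fin k}
    (h : attachLeaves e D f = attachLeaves e D' f') : D = D' ∧ f = f' := by
  constructor
  · ext i j
    rw [← attachLeaves_adj_coe_coe (e := e) (f := f), h, attachLeaves_adj_coe_coe]
  · ext m : 1
    have := (attachLeaves_adj_leaf (D := D) (f := f) (m := m)).2 rfl
    rw [h, attachLeaves_adj_leaf] at this
    exact (e.injective this).symm

/-- Every tree in which all vertices outside the range of `e` are leaves arises by attaching
leaves. -/
theorem exists_attachLeaves_eq {T : Digraph (Fin n)} (hT : IsRootedTree T)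
    (hl : ∀ m ∉ Set.range e, m ∈ leafSet T) :
    ∃ (D : Digraph (Fin k)) (f : {m // m ∉ Set.range e} → Fin k),
      IsRootedTree D ∧ attachLeaves e D f = T := by
  have htarget {x y} (h : T.Adj x y) : ∃ j, e j = y := by
    by_contra hy
    exact (mem_leafSet.1 (hl y hy)).2 x h
  have hpar (m : {m // m ∉ Set.range e}) : ∃ j, ∀ y, T.Adj m y ↔ e j = y := by
    obtain ⟨w, hw, hu⟩ := hT.exists_adj_of_mem_leafSet (hl m m.2)
    obtain ⟨j, rfl⟩ := htarget hw
    exact ⟨j, fun y => ⟨fun h => (hu y h).symm, fun h => h ▸ hw⟩⟩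
  choose f hf using hpar
  refine ⟨⟨fun i j => T.Adj (e i) (e j)⟩, f, ?_, ?_⟩
  · have hT' := hT
    obtain ⟨hac, r, hr, hp⟩ := isRootedTree_iff.1 hT
    have hre : r ∈ Set.range e := by
      by_contra h
      obtain ⟨w, hw, -⟩ := hT'.exists_adj_of_mem_leafSet (hl r h)
      exact hr w hw
    obtain ⟨i₀, rfl⟩ := hre
    refine isRootedTree_iff.2 ⟨fun i hi => hac (e i) (Relation.TransGen.lift e (fun _ _ h => h) _ _ hi),
      i₀, fun j => hr (e j), fun i hi => ?_⟩
    obtain ⟨w, hw, hu⟩ := hp (e i) (fun h => hi (e.injective h))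
    obtain ⟨j, rfl⟩ := htarget hw
    exact ⟨j, hw, fun l hl => e.injective (hu _ hl)⟩
  · ext x y
    by_cases hx : x ∈ Set.range e
    · obtain ⟨i, rfl⟩ := hx
      rw [attachLeaves_adj_coe]
      constructor
      · rintro ⟨j, rfl, h⟩
        exact h
      · intro h
        obtain ⟨j, rfl⟩ := htarget h
        exact ⟨j, rfl, h⟩
    · rw [attachLeaves_adj_leaf (m := ⟨x, hx⟩), hf ⟨x, hx⟩]

theorem sum_eq_sum_range_add_sum_compl {M : Type*} [AddCommMonoid M]
    [Fintype {m // m ∉ Set.range e}] (g : Fin n → M) :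
    ∑ x, g x = ∑ i, g (e i) + ∑ m : {m // m ∉ Set.range e}, g m := by
  classical
  rw [← Fintype.sum_subtype_add_sum_subtype (fun x => x ∈ Set.range e) g]
  congr 1
  · convert (Fintype.sum_equiv (Equiv.ofInjective e e.injective) (fun i => g (e i))
      (fun x => g x) fun _ => rfl).symm
  · exact sum_congr (by ext; simp) fun _ _ => rfl

open scoped Classical in
theorem numDescents_eq_sum {n : ℕ} (D : Digraph (Fin n)) :
    numDescents D = ∑ x, ∑ y, if D.Adj x y ∧ y < x then 1 else 0 := by
  rw [numDescents, card_filter, ← univ_product_univ, sum_product]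

open scoped Classical in
theorem numDescents_attachLeaves :
    numDescents (attachLeaves e D f) =
      numDescents D + ∑ m : {m // m ∉ Set.range e}, if e (f m) < m then 1 else 0 := by
  rw [numDescents_eq_sum, sum_eq_sum_range_add_sum_compl (e := e), numDescents_eq_sum]
  congr 1
  · refine sum_congr rfl fun i _ => ?_
    rw [sum_eq_sum_range_add_sum_compl (e := e)]
    simp only [attachLeaves_adj_coe_coe, e.lt_iff_lt]
    rw [add_eq_left]
    exact sum_eq_zero fun m _ => if_neg fun h => m.2 (mem_range_of_attachLeaves_adj h.1)
  · refine sum_congr rfl fun m _ => ?_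
    simp only [attachLeaves_adj_leaf]
    rw [sum_eq_single (e (f m))]
    · simp
    · exact fun y _ hy => if_neg fun h => hy h.1.symm
    · simp

open scoped Classical in
/-- Attaching leaves is a bijection from the pairs of a tree on `Fin k` and an attachment function to
the trees on `Fin n` in which all vertices outside the range of `e` are leaves. Since `e` is strictly
increasing, it preserves the descents of the smaller tree. -/
theorem sum_trees_with_leaves_off_range {R : Type*} [CommRing R] (u : R) (e : Fin k ↪o Fin n) :
    ∑ T : Digraph (Fin n) with IsRootedTree T ∧ ∀ m ∉ Set.range e, m ∈ leafSet T,
        u ^ numDescents T =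
      treeSum u 1 k * ∏ m : {m // m ∉ Set.range e}, ∑ i, if e i < m then u else 1 := by
  rw [prod_univ_sum, treeSum, sum_mul_sum, ← sum_product', eq_comm]
  refine sum_nbij (fun p => attachLeaves e p.1 p.2) ?_ ?_ ?_ ?_
  · intro p hp
    have hD : IsRootedTree p.1 := by simpa using hp
    simpa using ⟨isRootedTree_attachLeaves hD, fun m hm =>
      mem_leafSet_attachLeaves (e := e) hD (by simpa using hm)⟩
  · intro p _ q _ h
    exact Prod.ext_iff.2 (attachLeaves_injective h)
  · intro T hT
    have hT' : IsRootedTree T ∧ ∀ m ∉ Set.range e, m ∈ leafSet T := by simpa using hT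
    obtain ⟨D, f, hD, h⟩ := exists_attachLeaves_eq hT'.1 hT'.2
    exact ⟨(D, f), by simpa using hD, h⟩
  · intro p _
    rw [one_pow, mul_one, numDescents_attachLeaves, pow_add, ← prod_pow_eq_pow_sum]
    congr 1
    refine prod_congr rfl fun m _ => ?_
    split_ifs <;> simp

/-- Choosing a set of leaves to be weighted with `α`, and sorting by the set of the remaining
vertices, expresses the leaf weight `α + 1` through trees without leaf weight. -/
theorem treeSum_add_one {R : Type*} [CommRing R] (u α : R) (n : ℕ) :
    treeSum u (α + 1) n = ∑ k ∈ range (n + 1),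
      treeSum u 1 k * attachmentSum α u (univ : Finset (Fin n)) k 0 := by
  classical
  have hexp : treeSum u (α + 1) n = ∑ K : Finset (Fin n),
      ∑ T : Digraph (Fin n) with IsRootedTree T ∧ Kᶜ ⊆ leafSet T,
        u ^ numDescents T * α ^ Kᶜ.card := by
    rw [Fintype.sum_bijective (compl : Finset (Fin n) → _) compl_bijective _
      (fun L => ∑ T : Digraph (Fin n) with IsRootedTree T ∧ L ⊆ leafSet T,
        u ^ numDescents T * α ^ L.card) fun _ => rfl]
    simp only [treeSum, sum_filter]
    rw [sum_comm]
    refine sum_congr rfl fun T _ => ?_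
    by_cases hT : IsRootedTree T
    · simp only [hT, if_true, true_and]
      rw [← sum_filter, ← mul_sum, numLeaves_eq_card_leafSet, ← prod_const, prod_add_one]
      congr 1
      refine sum_congr ?_ fun L _ => by rw [prod_const]
      ext L
      simp
    · simp [hT]
  rw [hexp, ← powerset_univ, sum_powerset, card_univ, Fintype.card_fin]
  refine sum_congr rfl fun k _ => ?_
  rw [attachmentSum, mul_sum]
  refine sum_congr rfl fun K hK => ?_
  have hKc : K.card = k := (mem_powersetCard.1 hK).2
  have hrange (m : Fin n) : m ∈ Set.range (K.orderEmbOfFin hKc) ↔ m ∈ K := by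
    rw [range_orderEmbOfFin]; rfl
  have h := sum_trees_with_leaves_off_range u (K.orderEmbOfFin hKc)
  rw [← sum_mul, prod_mul_distrib, prod_const, ← compl_eq_univ_sdiff]
  have hL : (univ.filter fun T : Digraph (Fin n) => IsRootedTree T ∧ Kᶜ ⊆ leafSet T) =
      univ.filter fun T : Digraph (Fin n) =>
        IsRootedTree T ∧ ∀ m ∉ Set.range (K.orderEmbOfFin hKc), m ∈ leafSet T := by
    ext T
    simp only [mem_filter, hrange, subset_iff, mem_compl]
  rw [hL, h, mul_assoc, mul_comm (α ^ _)]
  congr 2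
  rw [prod_subtype (p := fun m => m ∉ Set.range (K.orderEmbOfFin hKc)) Kᶜ
    (fun m => by rw [hrange, mem_compl])]
  refine prod_congr rfl fun m _ => ?_
  rw [zero_add, ← sum_image (f := fun r => if r < m.1 then u else 1) (s := univ)
    fun i _ j _ h => (K.orderEmbOfFin hKc).injective h, image_orderEmbOfFin_univ]

end Attach

/-! ### The functional equations -/

section FunctionalEquation

variable {R : Type*} [CommRing R] [Algebra ℚ R] (u α : R)

theorem coeff_treeEGF (n : ℕ) :
    coeff n (treeEGF u α) = algebraMap ℚ R (1 / (n.factorial : ℚ)) * treeSum u α n := by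
  simp [treeEGF]

theorem treeEGF_add_one :
    treeEGF u (α + 1) = subst (expQuotient α u) (treeEGF u 1) := by
  ext n
  rw [coeff_subst_eq_sum_range _ _ (constantCoeff_expQuotient α u), coeff_treeEGF,
    treeSum_add_one, mul_sum]
  refine sum_congr rfl fun k _ => ?_
  have h := factorial_mul_coeff_expSeries_mul_expQuotient_pow α u (univ : Finset (Fin n)) k 0
  have h0 : expSeries (0 : R) = 1 := by
    ext m
    rw [coeff_expSeries, coeff_one]
    cases m <;> simp
  rw [zero_mul, h0, one_mul, card_univ, Fintype.card_fin] at h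
  rw [coeff_treeEGF]
  have hn := natCast_mul_algebraMap_factorial (R := R) n
  have hk := natCast_mul_algebraMap_factorial (R := R) k
  generalize algebraMap ℚ R (1 / (n.factorial : ℚ)) = p at *
  generalize algebraMap ℚ R (1 / (k.factorial : ℚ)) = q at *
  linear_combination
    -(p * q * treeSum u 1 k) * h
    - (p * treeSum u 1 k * attachmentSum α u (univ : Finset (Fin n)) k 0) * hk
    + (q * treeSum u 1 k * coeff n (expQuotient α u ^ k)) * hn

theorem treeEGF_zero : treeEGF u 0 = (X : PowerSeries R) := by
  ext n
  rw [coeff_treeEGF, treeSum_zero_leaf_weight, coeff_X]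
  split_ifs with h
  · simp [h]
  · simp

theorem constantCoeff_treeEGF : constantCoeff (treeEGF u α) = 0 := by
  classical
  rw [← coeff_zero_eq_constantCoeff_apply, coeff_treeEGF, treeSum, sum_eq_zero, mul_zero]
  exact fun D hD => absurd (mem_filter.1 hD).2.one_le (by norm_num)

end FunctionalEquation

end DescentTrees

/-- `u` and `α` are arbitrary elements of a commutative `ℚ`-algebra; the formal identities are the
case of the two indeterminates of `ℚ[u, α]`, where `α (1 - u)` and `u - 1` are not zero divisors,
so that the two quotients are literally determined by the clauses about them.
`PowerSeries.subst g f` is `f(g(x))`. -/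
theorem proposition4p5 {R : Type*} [CommRing R] [Algebra ℚ R] (u α : R) :
    -- `S = (e^{αx} - e^{αux}) / (α(1-u))`, where the quotient is unique as soon as that makes sense
    (PowerSeries.C (α * (1 - u)) * DescentTrees.expQuotient α u =
        DescentTrees.expSeries α - DescentTrees.expSeries (α * u) ∧
      (α * (1 - u) ∈ nonZeroDivisors R → ∀ S : PowerSeries R,
        PowerSeries.C (α * (1 - u)) * S =
          DescentTrees.expSeries α - DescentTrees.expSeries (α * u) →
        S = DescentTrees.expQuotient α u) ∧
      PowerSeries.constantCoeff (DescentTrees.expQuotient α u) = 0) ∧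
    -- `T(x,u;α+1) = T(S, u)`, where `T(x,u) = T(x,u;1)`
    DescentTrees.treeEGF u (α + 1) =
      PowerSeries.subst (DescentTrees.expQuotient α u) (DescentTrees.treeEGF u 1) ∧
    -- `F = (e^{-x} - e^{-ux}) / (u-1) = ∑_{n ≥ 1} (-1)^{n-1} (1 + u + ⋯ + u^{n-1}) x^n / n!`
    ∃ F : PowerSeries R,
      F = PowerSeries.mk (fun n => if n = 0 then 0 else
        algebraMap ℚ R (1 / (n.factorial : ℚ)) *
          ((-1) ^ (n - 1) * ∑ i ∈ Finset.range n, u ^ i)) ∧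
      PowerSeries.C (u - 1) * F =
        DescentTrees.expSeries (-1) - DescentTrees.expSeries (-u) ∧
      (u - 1 ∈ nonZeroDivisors R → ∀ S : PowerSeries R,
        PowerSeries.C (u - 1) * S =
          DescentTrees.expSeries (-1) - DescentTrees.expSeries (-u) →
        S = F) ∧
      -- `T(x,u)` is the compositional inverse of `F`
      PowerSeries.constantCoeff F = 0 ∧
      PowerSeries.constantCoeff (DescentTrees.treeEGF u 1) = 0 ∧
      PowerSeries.subst F (DescentTrees.treeEGF u 1) = PowerSeries.X ∧
      PowerSeries.subst (DescentTrees.treeEGF u 1) F = PowerSeries.X := by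
  have hF : PowerSeries.C (u - 1) * DescentTrees.expQuotient (-1) u =
      DescentTrees.expSeries (-1) - DescentTrees.expSeries (-u) := by
    have h := DescentTrees.C_mul_expQuotient (-1) u
    rwa [neg_one_mul, neg_one_mul, neg_sub] at h
  have hTF : PowerSeries.subst (DescentTrees.expQuotient (-1) u) (DescentTrees.treeEGF u 1) =
      (PowerSeries.X : PowerSeries R) := by
    rw [← DescentTrees.treeEGF_add_one, neg_add_cancel, DescentTrees.treeEGF_zero]
  have hF1 : IsUnit (PowerSeries.coeff 1 (DescentTrees.expQuotient (-1) u)) := by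
    simp [DescentTrees.expQuotient]
  refine ⟨⟨DescentTrees.C_mul_expQuotient α u, fun hb S hS => ?_,
    DescentTrees.constantCoeff_expQuotient α u⟩, DescentTrees.treeEGF_add_one u α,
    DescentTrees.expQuotient (-1) u, rfl, hF, fun hb S hS => ?_,
    DescentTrees.constantCoeff_expQuotient (-1) u, DescentTrees.constantCoeff_treeEGF u 1, hTF,
    DescentTrees.subst_eq_X_of_subst_eq_X (DescentTrees.constantCoeff_expQuotient (-1) u) hF1 hTF⟩
  · exact DescentTrees.eq_of_C_mul_eq hb (hS.trans (DescentTrees.C_mul_expQuotient α u).symm)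
  · exact DescentTrees.eq_of_C_mul_eq hb (hS.trans hF.symm)
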